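/- In $SL(2,\mathbb Z)$ let $U=\begin{pmatrix}1&1\\0&1\end{pmatrix}$, $W=\begin{pmatrix}0&1\\-1&0\end{pmatrix}$ and $V=W^{-1}UW=\begin{pmatrix}1&0\\-1&1\end{pmatrix}$. To each type $T$ of fiber in Kodaira's list attach its monodromy matrix $M_T$ and the following factorization of $M_T$ into conjugates of $U$, called the minimal normal factorization (m.n.f.) of $M_T$ (the notation $(VU)^k$ stands for the sequence $V,U,\dots,V,U$ of $2k$ factors): - $wI_n$ ($w\ge1$, $n\ge 0$): $M_T=\begin{pmatrix}1&n\\0&1\end{pmatrix}$, m.n.f. $U^n$ (empty for $n=0$); - $II$: $M_T=\begin{pmatrix}1&1\\-1&0\end{pmatrix}$, m.n.f. $VU$; - $III$: $M_T=\begin{pmatrix}0&1\\-1&0\end{pmatrix}$, m.n.f. $VUV$; - $IV$: $M_T=\begin{pmatrix}0&1\\-1&-1\end{pmatrix}$, m.n.f. $(VU)^2$; - $I_n^*$ ($n\ge0$): $M_T=\begin{pmatrix}-1&-n\\0&-1\end{pmatrix}$, m.n.f. $U^n(VU)^3$; - $II^*$: $M_T=\begin{pmatrix}0&-1\\1&1\end{pmatrix}$,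 m.n.f. $(VU)^2(VU)^3$; - $III^*$: $M_T=\begin{pmatrix}0&-1\\1&0\end{pmatrix}$, m.n.f. $VUV(VU)^3$; - $IV^*$: $M_T=\begin{pmatrix}-1&-1\\1&0\end{pmatrix}$, m.n.f. $VU(VU)^3$. A Hurwitz move on a product $g_1\cdots g_r$ of elements of a group replaces, for some $1\le i\le r-1$, the pair of consecutive factors $(g_i,g_{i+1})$ by $(g_{i+1},\,g_{i+1}^{-1}g_ig_{i+1})$ or by $(g_ig_{i+1}g_i^{-1},\,g_i)$. **Theorem.** Let $M=M_T$ be one of these matrices and let $M=G_1\cdots G_r$ be a factorization of $M$ into $r\ge 0$ conjugates of $U$ in $SL(2,\mathbb Z)$. Then $r$ is greater than or equal to the number of factors in the m.n.f. of $M$. Moreover: - if $T$ is one of $wI_n$, $II$, $III$, $IV$, and $C_1\cdots C_n$ is the m.n.f. of $M$, then $s=(r-n)/12$ is a non-negative integer, and after a finite number of Hurwitz moves the product $G_1\cdots G_r$ becomes the product $C_1\cdots C_n(VU)^{6s}$; - if $T$ is one of $I_n^*$, $II^*$, $III^*$, $IV^*$, then $-M$ is again one of the matrices above, and if $C_1\cdots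 C_n$ is the m.n.f. of $-M$, then $s=(r-n-6)/12$ is a non-negative integer, and after a finite number of Hurwitz moves the product $G_1\cdots G_r$ becomes the product $C_1\cdots C_n(VU)^{6s+3}$. In both cases "becomes" is equality of sequences of factors. (In $wI_n$ and $I_n^*$ the subscript $n$ is the parameter of the type, and in the two bullets of the theorem $n$ is the number of factors $C_i$.) -/

import Mathlib

open scoped MatrixGroups

namespace KodairaFactorization

/-- `HurwitzMove l l'`: the ordered product `l'` arises from the ordered product `l` by applying one
Hurwitz move (of either of the two mutually inverse kinds) to two consecutive factors. -/
inductive HurwitzMove {G : Type*} [Group G] : List G → List G → Prop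
  | right (l₁ l₂ : List G) (a b : G) :
      HurwitzMove (l₁ ++ a :: b :: l₂) (l₁ ++ b :: (b⁻¹ * a * b) :: l₂)
  | left (l₁ l₂ : List G) (a b : G) :
      HurwitzMove (l₁ ++ a :: b :: l₂) (l₁ ++ (a * b * a⁻¹) :: a :: l₂)

/-- `l'` is obtained from `l` by a finite (possibly empty) sequence of Hurwitz moves. -/
def HurwitzEquiv {G : Type*} [Group G] (l l' : List G) : Prop :=
  Relation.ReflTransGen HurwitzMove l l'

def U : SL(2, ℤ) := ⟨!![1, 1; 0, 1], by simp [Matrix.det_fin_two]⟩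

def W : SL(2, ℤ) := ⟨!![0, 1; -1, 0], by simp [Matrix.det_fin_two]⟩

def V : SL(2, ℤ) := W⁻¹ * U * W

/-- The ordered product `(VU)^k`, as the sequence `V, U, V, U, …, V, U` of its `2 * k` factors. -/
def vuPow (k : ℕ) : List SL(2, ℤ) := (List.replicate k [V, U]).flatten

/-- The types of fibers in Kodaira's list; `I w n` is the type `wI_n` and `IStar n` is `I_n^*`. -/
inductive KodairaType
  | I (w : ℕ+) (n : ℕ)
  | II
  | III
  | IV
  | IStar (n : ℕ)
  | IIStar
  | IIIStar
  | IVStar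

namespace KodairaType

/-- The types `I_n^*`, `II^*`, `III^*`, `IV^*`. -/
def IsStarred : KodairaType → Prop
  | I _ _ | II | III | IV => False
  | IStar _ | IIStar | IIIStar | IVStar => True

/-- Kodaira's monodromy matrix `M_T` of a fiber of type `T`. -/
def monodromy : KodairaType → SL(2, ℤ)
  | I _ n => ⟨!![1, (n : ℤ); 0, 1], by simp [Matrix.det_fin_two]⟩
  | II => ⟨!![1, 1; -1, 0], by simp [Matrix.det_fin_two]⟩
  | III => ⟨!![0, 1; -1, 0], by simp [Matrix.det_fin_two]⟩
  | IV => ⟨!![0, 1; -1, -1], by simp [Matrix.det_fin_two]⟩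
  | IStar n => ⟨!![-1, -(n : ℤ); 0, -1], by simp [Matrix.det_fin_two]⟩
  | IIStar => ⟨!![0, -1; 1, 1], by simp [Matrix.det_fin_two]⟩
  | IIIStar => ⟨!![0, -1; 1, 0], by simp [Matrix.det_fin_two]⟩
  | IVStar => ⟨!![-1, -1; 1, 0], by simp [Matrix.det_fin_two]⟩

/-- The minimal normal factorization of `M_T`, as the sequence of its factors. (For `II^*` one has
`M_T = -(VU)^2` and for `IV^*` one has `M_T = -VU`, with `-1 = (VU)^3`.) -/
def mnf : KodairaType → List SL(2, ℤ)
  | I _ n => List.replicate n U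
  | II => [V, U]
  | III => [V, U, V]
  | IV => [V, U, V, U]
  | IStar n => List.replicate n U ++ vuPow 3
  | IIStar => [V, U, V, U] ++ vuPow 3
  | IIIStar => [V, U, V] ++ vuPow 3
  | IVStar => [V, U] ++ vuPow 3

end KodairaType

/-- `C` is the minimal normal factorization of the matrix `M` of Kodaira's list. -/
def IsMNF (M : SL(2, ℤ)) (C : List SL(2, ℤ)) : Prop :=
  ∃ T : KodairaType, T.monodromy = M ∧ T.mnf = C

end KodairaFactorization

/-!
Write `delta = V * U`, an element of order `6` with `delta ^ 3 = -1`. Every matrix of Kodaira's list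
is `U ^ n * delta ^ m` with `n ≥ 0` and `0 ≤ m < 6`, and everything follows from one normal form
(`hurwitzEquiv_normalForm`): a product of conjugates of `U` that equals `U ^ n * delta ^ m` is
Hurwitz equivalent to `U, …, U, V, U, …, V, U` with `n` factors `U` in front and `m + 6 * s` pairs
`V, U` behind. Lengths are preserved by Hurwitz moves, so this also gives the number of factors.

The normal form comes from a cancellation argument in the trivalent Farey tree on which `SL(2, ℤ)`
acts, `delta` fixing a base vertex `o` and `W` reversing an edge at `o`. A conjugate `g` of `U`
shifts by one step the boundary of a complementary region (a cusp) of the planar tree. If that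
region has distance `d` from `o`, the path from `o` to `g o` has length `2 * d + 1`, and its middle
edge lies on the boundary of the region. Consider two consecutive factors `g, h` and the paths from
`o` to `g⁻¹ o` and `h o`. If one of the paths contains the middle edge of the other and the depths
`d` differ, a Hurwitz move makes the deeper of the two regions come closer to `o`
(`Cusp.exists_conj_inv_of_prefix`, `Cusp.exists_conj_of_prefix`). If the depths agree, they are `0`
and the pair is Hurwitz equivalent to `V, U` (`Cusp.hurwitzEquiv_of_not_apart_of_depth_eq`), which
can be moved to the right end at the cost of conjugating other factors by `delta`, and this
preserves depths. Hence every product becomes a reduced one followed by pairs `V, U`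
(`exists_reduced`).

In a reduced product the half-trees beyond the middle edges are disjoint for neighbours, and by
ping-pong the image of `o` under the product lies beyond the middle edge of the first factor
(`Cusp.beyond_head_of_isChain`). For `U ^ n * delta ^ k` this image lies on the boundary of the
region fixed by `U`, at distance `n`. This forces `n ≠ 0` and the first factor to be `U`, and by
induction the reduced product is `U, …, U` (`Cusp.eq_replicate_of_isChain`).

Vertices, edges and half-trees are handled through matrices: an edge pointing away from `o` is a
word (`edge`), and a half-tree is given by sign conditions on matrix entries (`Ahead`, `Beyond`).
-/

namespace KodairaFactorization

/-! ### Hurwitz equivalence of lists -/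

section Hurwitz

variable {G : Type*} [Group G]

theorem HurwitzMove.length_eq {l l' : List G} (h : HurwitzMove l l') : l.length = l'.length := by
  cases h <;> simp

theorem HurwitzMove.prod_eq {l l' : List G} (h : HurwitzMove l l') : l.prod = l'.prod := by
  cases h <;> simp [mul_assoc]

theorem HurwitzMove.append_append {l l' : List G} (h : HurwitzMove l l') (p s : List G) :
    HurwitzMove (p ++ l ++ s) (p ++ l' ++ s) := by
  cases h with
  | right l₁ l₂ a b => simpa using HurwitzMove.right (p ++ l₁) (l₂ ++ s) a b
  | left l₁ l₂ a b => simpa using HurwitzMove.left (p ++ l₁) (l₂ ++ s) a b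

theorem HurwitzEquiv.refl (l : List G) : HurwitzEquiv l l := Relation.ReflTransGen.refl

theorem HurwitzEquiv.trans {l₁ l₂ l₃ : List G} (h : HurwitzEquiv l₁ l₂)
    (h' : HurwitzEquiv l₂ l₃) : HurwitzEquiv l₁ l₃ :=
  Relation.ReflTransGen.trans h h'

theorem HurwitzEquiv.length_eq {l l' : List G} (h : HurwitzEquiv l l') :
    l.length = l'.length := by
  induction h with
  | refl => rfl
  | tail _ h ih => exact ih.trans h.length_eq

theorem HurwitzEquiv.prod_eq {l l' : List G} (h : HurwitzEquiv l l') : l.prod = l'.prod := by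
  induction h with
  | refl => rfl
  | tail _ h ih => exact ih.trans h.prod_eq

theorem HurwitzEquiv.append_append {l l' : List G} (h : HurwitzEquiv l l') (p s : List G) :
    HurwitzEquiv (p ++ l ++ s) (p ++ l' ++ s) := by
  induction h with
  | refl => exact .refl _
  | tail _ h ih => exact Relation.ReflTransGen.tail ih (h.append_append p s)

theorem HurwitzEquiv.append_right {l l' : List G} (h : HurwitzEquiv l l') (s : List G) :
    HurwitzEquiv (l ++ s) (l' ++ s) := by
  simpa using h.append_append [] s

theorem hurwitzEquiv_right (a b : G) : HurwitzEquiv [a, b] [b, b⁻¹ * a * b] :=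
  Relation.ReflTransGen.single (HurwitzMove.right [] [] a b)

theorem hurwitzEquiv_left (a b : G) : HurwitzEquiv [a, b] [a * b * a⁻¹, a] :=
  Relation.ReflTransGen.single (HurwitzMove.left [] [] a b)

/-- A pair of factors can be moved to the right end of a product, conjugating the factors that it
passes by the product of the pair. -/
theorem hurwitzEquiv_slide (a b : G) (l : List G) :
    HurwitzEquiv (a :: b :: l) (l.map (fun g => a * b * g * (a * b)⁻¹) ++ [a, b]) := by
  induction l with
  | nil => exact .refl _
  | cons g l ih =>
    have h₁ : HurwitzEquiv (a :: b :: g :: l) (a :: (b * g * b⁻¹) :: b :: l) := by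
      simpa using (hurwitzEquiv_left b g).append_append [a] l
    have h₂ : HurwitzEquiv (a :: (b * g * b⁻¹) :: b :: l)
        ((a * b * g * (a * b)⁻¹) :: a :: b :: l) := by
      simpa [mul_assoc] using (hurwitzEquiv_left a (b * g * b⁻¹)).append_append [] (b :: l)
    have h₃ := ih.append_append [a * b * g * (a * b)⁻¹] []
    simp only [List.append_nil, List.singleton_append] at h₃
    exact (h₁.trans h₂).trans h₃

/-- The braid relation lets one pass from `a, b, a` to `b, a, b`. -/
theorem hurwitzEquiv_braid {a b : G} (h : a * b * a = b * a * b) :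
    HurwitzEquiv [a, b, a] [b, a, b] := by
  have h₁ := (hurwitzEquiv_right a b).append_append [] [a]
  have h₂ := (hurwitzEquiv_right (b⁻¹ * a * b) a).append_append [b] []
  have e : a⁻¹ * (b⁻¹ * a * b) * a = b := by
    have : a⁻¹ * (b⁻¹ * a * b) * a = a⁻¹ * b⁻¹ * (a * b * a) := by group
    rw [this, h]; group
  rw [e] at h₂
  exact HurwitzEquiv.trans (by simpa using h₁) (by simpa using h₂)

end Hurwitz

/-! ### The generators of the modular group -/

/-- The element `VU` of order `6`, whose cube is `-1`. -/
def delta : SL(2, ℤ) := V * U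

/-- The elementary matrix that together with `U` freely generates the monoid of matrices in
`SL(2, ℤ)` with nonnegative entries. -/
def lowerU : SL(2, ℤ) := ⟨!![1, 0; 1, 1], by simp [Matrix.det_fin_two]⟩

theorem delta_pow_three : delta ^ 3 = -1 := by decide

theorem delta_pow_six : delta ^ 6 = 1 := by decide

theorem W_inv : W⁻¹ = -W := by decide

theorem U_eq : U = W * delta⁻¹ := by decide

theorem delta_pow_injOn {k m : ℕ} (hm : m < 6) (h : delta ^ k = delta ^ m) :
    ∃ s, k = m + 6 * s := by
  have h' : delta ^ (k % 6) = delta ^ m := by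
    rw [← h]; conv_rhs => rw [← Nat.mod_add_div k 6, pow_add, pow_mul, delta_pow_six]
    simp
  have key : ∀ a < 6, ∀ b < 6, delta ^ a = delta ^ b → a = b := by decide
  have := key _ (Nat.mod_lt k (by norm_num)) _ hm h'
  exact ⟨k / 6, by omega⟩

/-! ### Edges of the Farey tree and half-trees -/

/-- The matrix of a word in the two free generators of the monoid of nonnegative matrices of
`SL(2, ℤ)`, with `true` standing for `lowerU`
(a turn to the left in the Farey tree) and `false` for `U` (a turn to the right). -/
def wordMatrix (w : List Bool) : SL(2, ℤ) :=
  (w.map fun b => if b then lowerU else U).prod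

/-- An oriented edge of the trivalent Farey tree pointing away from the base vertex (the vertex
fixed by `delta`), encoded by a matrix: the edge leaves the base vertex in one of the three
directions `j` and then turns left or right as prescribed by `w`. -/
def edge (j : Fin 3) (w : List Bool) : SL(2, ℤ) := delta ^ (j : ℕ) * wordMatrix w

@[simp] theorem wordMatrix_nil : wordMatrix [] = 1 := rfl

theorem wordMatrix_cons (b : Bool) (w : List Bool) :
    wordMatrix (b :: w) = (if b then lowerU else U) * wordMatrix w := by
  simp [wordMatrix]

theorem wordMatrix_append (w w' : List Bool) :
    wordMatrix (w ++ w') = wordMatrix w * wordMatrix w' := by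
  simp [wordMatrix]

theorem edge_append (j : Fin 3) (w w' : List Bool) :
    edge j (w ++ w') = edge j w * wordMatrix w' := by
  simp [edge, wordMatrix_append, mul_assoc]

/-- The vertices of the Farey tree are the images under `SL(2, ℤ)` of the base vertex, which is the
Farey triangle with corners `(1, 0)`, `(0, 1)`, `(1, -1)`. `Ahead X` says that the image of the base
vertex under `X` lies in the half-tree beyond the edge `edge 0 []`: the three columns `X (1, 0)`,
`X (0, 1)`, `X (1, -1)` lie, up to sign, in the closed first quadrant. -/
def Ahead (X : SL(2, ℤ)) : Prop :=
  0 ≤ X 0 0 * X 1 0 ∧ 0 ≤ X 0 1 * X 1 1 ∧ 0 ≤ (X 0 0 - X 0 1) * (X 1 0 - X 1 1)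

/-- The image of the base vertex under `X` lies in the half-tree beyond the edge with matrix `e`. -/
def Beyond (e X : SL(2, ℤ)) : Prop := Ahead (e⁻¹ * X)

theorem Ahead.congr_of_entries {X Y : SL(2, ℤ)} (h : Ahead X)
    (h00 : Y 0 0 * Y 1 0 = X 0 0 * X 1 0) (h01 : Y 0 1 * Y 1 1 = X 0 1 * X 1 1)
    (h2 : (Y 0 0 - Y 0 1) * (Y 1 0 - Y 1 1) = (X 0 0 - X 0 1) * (X 1 0 - X 1 1)) : Ahead Y := by
  unfold Ahead; rw [h00, h01, h2]; exact h

theorem Ahead.neg {X : SL(2, ℤ)} (h : Ahead X) : Ahead (-X) := by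
  refine h.congr_of_entries ?_ ?_ ?_ <;> (simp; try ring)

theorem ahead_neg_iff {X : SL(2, ℤ)} : Ahead (-X) ↔ Ahead X :=
  ⟨fun h => by simpa using h.neg, Ahead.neg⟩

theorem beyond_neg_iff {e X : SL(2, ℤ)} : Beyond e (-X) ↔ Beyond e X := by
  simp [Beyond, ahead_neg_iff]

theorem mul_entry (X Y : SL(2, ℤ)) (i j : Fin 2) :
    (X * Y) i j = X i 0 * Y 0 j + X i 1 * Y 1 j := by
  simp [Matrix.mul_apply, Fin.sum_univ_two]

theorem U_entries : U 0 0 = 1 ∧ U 0 1 = 1 ∧ U 1 0 = 0 ∧ U 1 1 = 1 := by decide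

theorem lowerU_entries : lowerU 0 0 = 1 ∧ lowerU 0 1 = 0 ∧ lowerU 1 0 = 1 ∧ lowerU 1 1 = 1 := by
  decide

theorem W_entries : W 0 0 = 0 ∧ W 0 1 = 1 ∧ W 1 0 = -1 ∧ W 1 1 = 0 := by decide

theorem delta_entries : delta 0 0 = 1 ∧ delta 0 1 = 1 ∧ delta 1 0 = -1 ∧ delta 1 1 = 0 := by
  decide

theorem det_entries (X : SL(2, ℤ)) : X 0 0 * X 1 1 - X 0 1 * X 1 0 = 1 := by
  rw [← Matrix.det_fin_two]; exact X.2

theorem Ahead.mul_delta {X : SL(2, ℤ)} (h : Ahead X) : Ahead (X * delta) := by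
  obtain ⟨h0, h1, h2⟩ := h
  obtain ⟨a, b, c, d⟩ := delta_entries
  simp only [Ahead, mul_entry, a, b, c, d]
  refine ⟨?_, ?_, ?_⟩ <;> nlinarith

theorem Ahead.mul_delta_pow {X : SL(2, ℤ)} (h : Ahead X) (k : ℕ) : Ahead (X * delta ^ k) := by
  induction k with
  | zero => simpa using h
  | succ k ih => rw [pow_succ, ← mul_assoc]; exact ih.mul_delta

theorem Ahead.of_mul_delta_pow {X : SL(2, ℤ)} {k : ℕ} (h : Ahead (X * delta ^ k)) : Ahead X := by
  have := h.mul_delta_pow (5 * k)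
  rwa [mul_assoc, ← pow_add, show k + 5 * k = 6 * k by ring, pow_mul, delta_pow_six, one_pow,
    mul_one] at this

theorem Beyond.of_mul_delta_pow {e X : SL(2, ℤ)} {k : ℕ} (h : Beyond e (X * delta ^ k)) :
    Beyond e X :=
  Ahead.of_mul_delta_pow (k := k) (by rwa [Beyond, ← mul_assoc] at h)

/-- Two vectors of determinant `±1` cannot lie in the interiors of two adjacent quadrants. -/
theorem mul_nonpos_of_det_eq {a b c d : ℤ} (hdet : a * d - b * c = 1 ∨ a * d - b * c = -1)
    (h : a * c < 0) : b * d ≤ 0 := by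
  by_contra! hbd
  have key : (a * d) * (b * c) < 0 := by nlinarith
  have : (a * d) * (b * c) ≥ 0 := by
    rcases hdet with h | h
    · have : a * d = b * c + 1 := by linarith
      rw [this]; nlinarith [sq_nonneg (b * c), Int.le_self_sq (-(b*c))]
    · have : a * d = b * c - 1 := by linarith
      rw [this]; nlinarith [sq_nonneg (b * c), Int.le_self_sq (b*c)]
  omega

/-- The rotation `W` about the middle of the edge `edge 0 []` exchanges the two half-trees. -/
theorem ahead_W_mul_of_not_ahead {X : SL(2, ℤ)} (h : ¬ Ahead X) : Ahead (W * X) := by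
  obtain ⟨a, b, c, d⟩ := W_entries
  have hX := det_entries X
  simp only [Ahead, mul_entry, a, b, c, d]
  simp only [Ahead, not_and_or, not_le] at h
  generalize X 0 0 = p at *
  generalize X 0 1 = q at *
  generalize X 1 0 = r at *
  generalize X 1 1 = s at *
  suffices p * r ≤ 0 ∧ q * s ≤ 0 ∧ (p - q) * (r - s) ≤ 0 by
    obtain ⟨h0, h1, h2⟩ := this
    refine ⟨?_, ?_, ?_⟩ <;> nlinarith
  rcases h with h | h | h
  · exact ⟨h.le, mul_nonpos_of_det_eq (by left; linarith) h,
      mul_nonpos_of_det_eq (by right; linarith) h⟩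
  · exact ⟨mul_nonpos_of_det_eq (by right; linarith) h, h.le,
      mul_nonpos_of_det_eq (by right; linarith) h⟩
  · exact ⟨mul_nonpos_of_det_eq (by left; linarith) h,
      mul_nonpos_of_det_eq (by left; linarith) h, h.le⟩

theorem Ahead.lowerU_mul {X : SL(2, ℤ)} (h : Ahead X) : Ahead (lowerU * X) := by
  obtain ⟨h0, h1, h2⟩ := h
  obtain ⟨a, b, c, d⟩ := lowerU_entries
  simp only [Ahead, mul_entry, a, b, c, d]
  refine ⟨?_, ?_, ?_⟩ <;>
    nlinarith [sq_nonneg (X 0 0), sq_nonneg (X 0 1), sq_nonneg (X 0 0 - X 0 1)]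

theorem Ahead.U_mul {X : SL(2, ℤ)} (h : Ahead X) : Ahead (U * X) := by
  obtain ⟨h0, h1, h2⟩ := h
  obtain ⟨a, b, c, d⟩ := U_entries
  simp only [Ahead, mul_entry, a, b, c, d]
  refine ⟨?_, ?_, ?_⟩ <;>
    nlinarith [sq_nonneg (X 1 0), sq_nonneg (X 1 1), sq_nonneg (X 1 0 - X 1 1)]

theorem Ahead.wordMatrix_mul {X : SL(2, ℤ)} (h : Ahead X) (w : List Bool) :
    Ahead (wordMatrix w * X) := by
  induction w with
  | nil => simpa using h
  | cons b w ih =>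
    rw [wordMatrix_cons, mul_assoc]
    cases b
    · exact ih.U_mul
    · exact ih.lowerU_mul

/-- The half-trees to the left and to the right are disjoint. -/
theorem lowerU_mul_ne_U_mul {X Y : SL(2, ℤ)} (hX : Ahead X) (hY : Ahead Y) :
    lowerU * X ≠ U * Y := by
  intro h
  obtain ⟨a, b, c, d⟩ := lowerU_entries
  obtain ⟨a', b', c', d'⟩ := U_entries
  have e (i j : Fin 2) : (lowerU * X) i j = (U * Y) i j := by rw [h]
  have e0 := e 0 0
  have e1 := e 0 1
  have e2 := e 1 0
  have e3 := e 1 1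
  simp only [mul_entry, a, b, c, d, a', b', c', d', one_mul, zero_mul, add_zero, zero_add]
    at e0 e1 e2 e3
  obtain ⟨h0, h1, -⟩ := hX
  obtain ⟨k0, k1, -⟩ := hY
  have hd := det_entries Y
  rw [e0] at *
  rw [e1] at *
  have : Y 0 0 = 0 := by
    have : X 1 0 = - Y 0 0 := by linarith
    rw [this] at h0
    nlinarith [sq_nonneg (Y 0 0)]
  have : Y 0 1 = 0 := by
    have : X 1 1 = - Y 0 1 := by linarith
    rw [this] at h1
    nlinarith [sq_nonneg (Y 0 1)]
  simp_all

theorem not_ahead_delta_mul {X : SL(2, ℤ)} (hX : Ahead X) : ¬ Ahead (delta * X) := by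
  rintro ⟨h0, h1, -⟩
  obtain ⟨a, b, c, d⟩ := delta_entries
  have hd := det_entries X
  simp only [mul_entry, a, b, c, d] at h0 h1
  obtain ⟨k0, k1, -⟩ := hX
  have : X 0 0 = 0 := by nlinarith [sq_nonneg (X 0 0)]
  have : X 0 1 = 0 := by nlinarith [sq_nonneg (X 0 1)]
  simp_all

theorem not_ahead_one : ¬ Ahead 1 := by simp [Ahead]

/-- The three half-trees at the base vertex are disjoint. -/
theorem eq_of_delta_pow_mul_eq {X Y : SL(2, ℤ)} (hX : Ahead X) (hY : Ahead Y) {i j : Fin 3}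
    (h : delta ^ (i : ℕ) * X = delta ^ (j : ℕ) * Y) : i = j := by
  wlog hij : i < j generalizing i j X Y with H
  · rcases lt_trichotomy i j with h' | h' | h'
    · exact absurd h' hij
    · exact h'
    · exact (H hY hX h.symm h').symm
  exfalso
  obtain ⟨k, hk⟩ : ∃ k, (j : ℕ) = i + (k + 1) := ⟨j - i - 1, by omega⟩
  have hk2 : k < 2 := by omega
  rw [hk, pow_add, mul_assoc, mul_right_inj] at h
  interval_cases k
  · rw [zero_add, pow_one] at h
    exact not_ahead_delta_mul hY (h ▸ hX)
  · refine not_ahead_delta_mul hX ?_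
    rw [h, ← mul_assoc, show delta * delta ^ (1 + 1) = -1 by decide]
    simpa using hY.neg

/-- The base vertex is beyond none of the edges pointing away from it. -/
theorem not_beyond_edge_one (j : Fin 3) (w : List Bool) : ¬ Beyond (edge j w) 1 := by
  intro h
  have h' := h.wordMatrix_mul w
  have e : wordMatrix w * ((edge j w)⁻¹ * 1) = (delta ^ (j : ℕ))⁻¹ := by simp [edge]
  rw [e] at h'
  refine not_ahead_one (Ahead.of_mul_delta_pow (k := 5 * j) ?_)
  have : (delta ^ (j : ℕ))⁻¹ = delta ^ (5 * (j : ℕ)) := by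
    rw [inv_eq_iff_mul_eq_one, ← pow_add, show (j : ℕ) + 5 * j = 6 * j by ring, pow_mul,
      delta_pow_six, one_pow]
  simpa [← this] using h'

/-- Two half-trees which have a vertex in common are nested. -/
theorem prefix_or_prefix_of_ahead (w w' : List Bool) {X Y : SL(2, ℤ)} (hX : Ahead X) (hY : Ahead Y)
    (h : wordMatrix w * X = wordMatrix w' * Y) : w <+: w' ∨ w' <+: w := by
  induction w generalizing w' with
  | nil => exact Or.inl List.nil_prefix
  | cons b w ih =>
    cases w' with
    | nil => exact Or.inr List.nil_prefix
    | cons b' w' =>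
      rw [wordMatrix_cons, wordMatrix_cons, mul_assoc, mul_assoc] at h
      have hX' := hX.wordMatrix_mul w
      have hY' := hY.wordMatrix_mul w'
      cases b <;> cases b'
      · simpa [List.cons_prefix_cons] using ih w' (by simpa using h)
      · exact absurd h.symm (lowerU_mul_ne_U_mul hY' hX')
      · exact absurd h (lowerU_mul_ne_U_mul hX' hY')
      · simpa [List.cons_prefix_cons] using ih w' (by simpa using h)

theorem Beyond.nested {i j : Fin 3} {w w' : List Bool} {X : SL(2, ℤ)} (h : Beyond (edge i w) X)
    (h' : Beyond (edge j w') X) : i = j ∧ (w <+: w' ∨ w' <+: w) := by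
  have e : delta ^ (i : ℕ) * (wordMatrix w * ((edge i w)⁻¹ * X)) =
      delta ^ (j : ℕ) * (wordMatrix w' * ((edge j w')⁻¹ * X)) := by
    simp [edge, mul_assoc]
  have hij := eq_of_delta_pow_mul_eq (h.wordMatrix_mul w) (h'.wordMatrix_mul w') e
  subst hij
  exact ⟨rfl, prefix_or_prefix_of_ahead w w' h h' (by simpa using e)⟩

theorem U_pow_entries (n : ℕ) :
    (U ^ n) 0 0 = 1 ∧ (U ^ n) 0 1 = n ∧ (U ^ n) 1 0 = 0 ∧ (U ^ n) 1 1 = 1 := by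
  obtain ⟨a, b, c, d⟩ := U_entries
  induction n with
  | zero => simp
  | succ n ih =>
    obtain ⟨p, q, r, s⟩ := ih
    simp [pow_succ, mul_entry, a, b, c, d, p, q, r, s, add_comm]

theorem ahead_U_pow_succ (n : ℕ) : Ahead (U ^ (n + 1)) := by
  obtain ⟨p, q, r, s⟩ := U_pow_entries (n + 1)
  simp only [Ahead, p, q, r, s]
  simp
  positivity

theorem U_pow_ne_lowerU_mul {X : SL(2, ℤ)} (hX : Ahead X) (n : ℕ) : U ^ n ≠ lowerU * X := by
  intro h
  obtain ⟨p, q, r, s⟩ := U_pow_entries n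
  obtain ⟨a, b, c, d⟩ := lowerU_entries
  have e0 : (U ^ n) 0 0 = (lowerU * X) 0 0 := by rw [h]
  have e1 : (U ^ n) 1 0 = (lowerU * X) 1 0 := by rw [h]
  simp only [mul_entry, a, b, c, d, p, r] at e0 e1
  have := hX.1
  nlinarith

/-- The path from the base vertex to its image under `U ^ n` never turns left. -/
theorem U_pow_ne_wordMatrix_mul {X : SL(2, ℤ)} (hX : Ahead X) (w : List Bool) (n : ℕ) :
    U ^ n ≠ wordMatrix (w ++ [true]) * X := by
  induction w generalizing n with
  | nil => simpa [wordMatrix_cons] using U_pow_ne_lowerU_mul hX n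
  | cons b w ih =>
    intro h
    rw [List.cons_append, wordMatrix_cons, mul_assoc] at h
    have hX' := hX.wordMatrix_mul (w ++ [true])
    cases b
    · cases n with
      | zero => exact not_ahead_one (by rw [← pow_zero U, h]; exact hX'.U_mul)
      | succ n => exact ih n (by simpa [pow_succ'] using h)
    · exact U_pow_ne_lowerU_mul hX' n h

/-! ### Conjugates of `U` encoded by cusps -/

/-- A code for a conjugate of `U`, equivalently for a complementary region of the planar Farey tree:
`near i` is one of the three regions touching the base vertex, and `far j w` is the region that one
sees straight ahead at the end of the edge `edge j w`. -/
inductive Cusp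
  | near (i : Fin 3)
  | far (j : Fin 3) (w : List Bool)

namespace Cusp

/-- The distance in the Farey tree from the base vertex to the region. -/
def depth : Cusp → ℕ
  | near _ => 0
  | far _ w => w.length + 1

@[simp] theorem depth_near (i : Fin 3) : (near i).depth = 0 := rfl

@[simp] theorem depth_far (j : Fin 3) (w : List Bool) : (far j w).depth = w.length + 1 := rfl

/-- The conjugate of `U` attached to a cusp. -/
def toSL : Cusp → SL(2, ℤ)
  | near i => delta ^ (i : ℕ) * U * (delta ^ (i : ℕ))⁻¹
  | far j w => edge j w * (lowerU * W * U⁻¹) * (edge j w)⁻¹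

/-- The conjugate `g` of `U` attached to a cusp shifts the boundary of its region by one step. So
the path from the base vertex `o` to `g • o` follows the shortest path to the region, then one edge
of its boundary, and then the image under `g` of the path back. `head` is this middle edge. -/
def head : Cusp → Fin 3 × List Bool
  | near i => (i, [])
  | far j w => (j, w ++ [true])

/-- The middle edge of the path from the base vertex to its image under the inverse of the
conjugate of `U` attached to the cusp. -/
def tail : Cusp → Fin 3 × List Bool
  | near i => (i + 1, [])
  | far j w => (j, w ++ [false])

/-- Conjugation by `delta` on cusps. -/
def rotate : Cusp → Cusp
  | near i => near (i + 1)
  | far j w => far (j + 1) w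

@[simp] theorem depth_rotate (x : Cusp) : x.rotate.depth = x.depth := by
  cases x <;> rfl

theorem delta_mul_delta_pow (i : Fin 3) :
    delta * delta ^ (i : ℕ) = delta ^ ((i + 1 : Fin 3) : ℕ) ∨
      delta * delta ^ (i : ℕ) = -delta ^ ((i + 1 : Fin 3) : ℕ) := by
  revert i; decide

theorem toSL_rotate (x : Cusp) : x.rotate.toSL = delta * x.toSL * delta⁻¹ := by
  cases x with
  | near i =>
    have : delta * (near i).toSL * delta⁻¹ =
      (delta * delta ^ (i : ℕ)) * U * (delta * delta ^ (i : ℕ))⁻¹ := by simp [toSL, mul_assoc]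
    rw [this]
    rcases delta_mul_delta_pow i with h | h <;> simp [h, rotate, toSL]
  | far j w =>
    have : delta * (far j w).toSL * delta⁻¹ =
        (delta * delta ^ (j : ℕ)) * wordMatrix w * (lowerU * W * U⁻¹) * (wordMatrix w)⁻¹ *
          (delta * delta ^ (j : ℕ))⁻¹ := by
      simp [toSL, edge, mul_assoc]
    rw [this]
    rcases delta_mul_delta_pow j with h | h <;>
      simp [h, rotate, toSL, edge, mul_assoc]

/-- A conjugate of `U` maps the complement of the half-tree beyond its tail onto the half-tree
beyond its head, the two half-trees of the edge `edge 0 []` being exchanged by `W`. -/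
theorem toSL_eq (x : Cusp) :
    x.toSL = edge x.head.1 x.head.2 * W * (edge x.tail.1 x.tail.2)⁻¹ ∨
      x.toSL = -(edge x.head.1 x.head.2 * W * (edge x.tail.1 x.tail.2)⁻¹) := by
  cases x with
  | near i => 
    simp only [toSL, head, tail, edge, wordMatrix_nil, mul_one]
    revert i; decide
  | far j w =>
    left
    simp [toSL, head, tail, edge_append, wordMatrix_cons, mul_assoc]

theorem length_head (x : Cusp) : x.head.2.length = x.depth := by
  cases x <;> simp [head, depth]

theorem length_tail (x : Cusp) : x.tail.2.length = x.depth := by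
  cases x <;> simp [tail, depth]

/-! ### Conjugation and depth -/

theorem exists_conj_delta_pow (x : Cusp) (k : ℕ) :
    ∃ y : Cusp, y.toSL = delta ^ k * x.toSL * (delta ^ k)⁻¹ ∧ y.depth = x.depth := by
  refine ⟨rotate^[k] x, ?_, ?_⟩
  · induction k with
    | zero => simp
    | succ k ih =>
      rw [Function.iterate_succ_apply', toSL_rotate, ih, pow_succ']
      simp [mul_assoc]
  · induction k with
    | zero => simp
    | succ k ih => rw [Function.iterate_succ_apply', depth_rotate, ih]

theorem conj_eq_of_eq_or_eq_neg {X Y : SL(2, ℤ)} (h : X = Y ∨ X = -Y) (g : SL(2, ℤ)) :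
    X * g * X⁻¹ = Y * g * Y⁻¹ := by
  rcases h with rfl | rfl <;> simp

/-- Up to powers of `delta`, the first factor `W` of a nonempty word cancels the additional `W`, and
if `u` is empty, the region straight ahead is turned into one that touches the base vertex. -/
theorem exists_conj_W_word (u : List Bool) :
    ∃ y : Cusp, y.toSL = W * wordMatrix u * (lowerU * W * U⁻¹) * (W * wordMatrix u)⁻¹ ∧
      y.depth ≤ u.length := by
  cases u with
  | nil => exact ⟨near 1, by decide, by simp⟩
  | cons b u =>
    cases b
    · refine ⟨far 2 u, ?_, by simp⟩
      have h : edge 2 u = W * wordMatrix (false :: u) := by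
        rw [wordMatrix_cons, ← mul_assoc,
          show W * (if false = true then lowerU else U) = delta ^ ((2 : Fin 3) : ℕ) by decide, edge]
      rw [← h, toSL]
    · refine ⟨far 1 u, ?_, by simp⟩
      have h : edge 1 u = W * wordMatrix (true :: u) := by
        rw [wordMatrix_cons, ← mul_assoc,
          show W * (if true = true then lowerU else U) = delta ^ ((1 : Fin 3) : ℕ) by decide, edge]
      rw [← h, toSL]

theorem exists_conj_W (x : Cusp) :
    ∃ y : Cusp, y.toSL = W * x.toSL * W⁻¹ ∧ y.depth ≤ x.depth + 1 := by
  cases x with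
  | near i =>
    fin_cases i
    · exact ⟨near 2, by decide, by simp⟩
    · exact ⟨far 0 [], by decide, by simp⟩
    · exact ⟨near 0, by decide, by simp⟩
  | far j w =>
    have h : W * (far j w).toSL * W⁻¹ = W * edge j w * (lowerU * W * U⁻¹) * (W * edge j w)⁻¹ := by
      simp [toSL, mul_assoc]
    rw [h]
    fin_cases j
    · obtain ⟨y, hy, hd⟩ := exists_conj_W_word w
      exact ⟨y, by simpa [edge] using hy, by simp only [depth_far]; omega⟩
    · refine ⟨far 0 (true :: w), ?_, by simp⟩
      refine conj_eq_of_eq_or_eq_neg ?_ _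
      right
      simp only [edge, wordMatrix_cons, ← mul_assoc, ← neg_mul]
      congr 1
      decide
    · refine ⟨far 0 (false :: w), ?_, by simp⟩
      refine conj_eq_of_eq_or_eq_neg ?_ _
      right
      simp only [edge, wordMatrix_cons, ← mul_assoc, ← neg_mul]
      congr 1
      decide

theorem exists_conj_wordMatrix (x : Cusp) (w : List Bool) :
    ∃ y : Cusp, y.toSL = wordMatrix w * x.toSL * (wordMatrix w)⁻¹ ∧
      y.depth ≤ x.depth + w.length := by
  induction w with
  | nil => exact ⟨x, by simp, by simp⟩
  | cons b w ih =>
    obtain ⟨y, hy, hd⟩ := ih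
    -- Both generators have the form `± W * delta ^ k`.
    obtain ⟨k, hk⟩ : ∃ k, (if b then lowerU else U) = W * delta ^ k ∨
        (if b then lowerU else U) = -(W * delta ^ k) := by
      cases b
      · exact ⟨2, by decide⟩
      · exact ⟨1, by decide⟩
    obtain ⟨z, hz, hzd⟩ := y.exists_conj_delta_pow k
    obtain ⟨t, ht, htd⟩ := z.exists_conj_W
    refine ⟨t, ?_, by simp only [List.length_cons]; omega⟩
    have := conj_eq_of_eq_or_eq_neg hk y.toSL
    rw [ht, hz, wordMatrix_cons]
    rw [hy] at this ⊢
    simp only [mul_inv_rev, mul_assoc] at this ⊢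
    exact this.symm

theorem exists_conj_edge (x : Cusp) (j : Fin 3) (w : List Bool) :
    ∃ y : Cusp, y.toSL = edge j w * x.toSL * (edge j w)⁻¹ ∧ y.depth ≤ x.depth + w.length := by
  obtain ⟨y, hy, hd⟩ := x.exists_conj_wordMatrix w
  obtain ⟨z, hz, hzd⟩ := y.exists_conj_delta_pow j
  exact ⟨z, by rw [hz, hy, edge]; simp [mul_assoc], by omega⟩

theorem exists_conj (X : SL(2, ℤ)) :
    ∀ x : Cusp, ∃ y : Cusp, y.toSL = X * x.toSL * X⁻¹ := by
  have hW (x : Cusp) : ∃ y : Cusp, y.toSL = W * x.toSL * W⁻¹ := x.exists_conj_W.imp fun _ h => h.1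
  have hWi (x : Cusp) : ∃ y : Cusp, y.toSL = W⁻¹ * x.toSL * W⁻¹⁻¹ := by
    obtain ⟨y, hy⟩ := hW x
    exact ⟨y, by rw [hy]; exact conj_eq_of_eq_or_eq_neg (by right; simp [W_inv]) _⟩
  have hU (x : Cusp) : ∃ y : Cusp, y.toSL = U * x.toSL * U⁻¹ := by
    obtain ⟨y, hy, -⟩ := x.exists_conj_wordMatrix [false]
    exact ⟨y, by simpa [wordMatrix_cons] using hy⟩
  have hUi (x : Cusp) : ∃ y : Cusp, y.toSL = U⁻¹ * x.toSL * U⁻¹⁻¹ := by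
    obtain ⟨y, hy⟩ := hWi x
    obtain ⟨z, hz, -⟩ := y.exists_conj_delta_pow 1
    exact ⟨z, by rw [hz, hy, U_eq]; simp [mul_assoc]⟩
  have hX : X ∈ Subgroup.closure {ModularGroup.S, ModularGroup.T} := by
    rw [SpecialLinearGroup.SL2Z_generators]; trivial
  have hS : ModularGroup.S = W⁻¹ := by decide
  have hT : ModularGroup.T = U := by decide
  rw [hS, hT] at hX
  induction hX using Subgroup.closure_induction'' with
  | mem y hy =>
    rcases hy with rfl | rfl
    · exact hWi
    · exact hU
  | inv_mem y hy =>
    rcases hy with rfl | rfl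
    · simpa using hW
    · exact hUi
  | one => exact fun x => ⟨x, by simp⟩
  | mul X Y _ _ hX hY =>
    intro x
    obtain ⟨y, hy⟩ := hY x
    obtain ⟨z, hz⟩ := hX y
    exact ⟨z, by rw [hz, hy]; simp [mul_assoc]⟩

theorem exists_toSL_eq {g : SL(2, ℤ)} (hg : IsConj U g) : ∃ x : Cusp, x.toSL = g := by
  obtain ⟨X, hX⟩ := isConj_iff.1 hg
  obtain ⟨y, hy⟩ := exists_conj X (near 0)
  exact ⟨y, by rw [hy, ← hX]; simp [toSL]⟩

/-! ### Shortening a pair of factors -/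

/-- Two consecutive factors do not cancel: the half-trees beyond the middle edges of their paths at
the common endpoint are disjoint. -/
def Apart (x y : Cusp) : Prop :=
  ¬ (x.tail.1 = y.head.1 ∧ (x.tail.2 <+: y.head.2 ∨ y.head.2 <+: x.tail.2))

/-- Right Hurwitz move: if the path of `x` runs through the middle edge of `y`, conjugating `x`
by the inverse of `y` brings its region closer. -/
theorem exists_conj_inv_of_prefix {x y : Cusp} (h1 : x.tail.1 = y.head.1)
    (h2 : y.head.2 <+: x.tail.2) (hlt : y.depth < x.depth) :
    ∃ z : Cusp, z.toSL = y.toSL⁻¹ * x.toSL * y.toSL ∧ z.depth < x.depth := by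
  cases x with
  | near i => simp at hlt
  | far j w =>
    obtain ⟨u, rfl⟩ : y.head.2 <+: w := by
      rcases List.prefix_concat_iff.1 (by simpa [tail] using h2) with h | h
      · have := congrArg List.length h
        rw [length_head] at this
        simp at this hlt
        omega
      · exact h
    simp only [tail] at h1
    subst h1
    obtain ⟨a, ha, had⟩ := exists_conj_W_word u
    obtain ⟨z, hz, hzd⟩ := a.exists_conj_edge y.tail.1 y.tail.2
    rw [length_tail] at hzd
    refine ⟨z, ?_, by simp only [depth_far, List.length_append, length_head]; omega⟩
    have hy : y.toSL⁻¹ = edge y.tail.1 y.tail.2 * W * (edge y.head.1 y.head.2)⁻¹ ∨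
        y.toSL⁻¹ = -(edge y.tail.1 y.tail.2 * W * (edge y.head.1 y.head.2)⁻¹) := by
      rcases y.toSL_eq with h | h
      · right; rw [h]; simp [mul_assoc, W_inv]
      · left; rw [h]; simp [mul_assoc, W_inv]
    have := conj_eq_of_eq_or_eq_neg hy (far y.head.1 (y.head.2 ++ u)).toSL
    rw [inv_inv] at this
    rw [this, hz, ha, toSL, edge_append]
    simp [mul_assoc]

/-- Left Hurwitz move: if the path of `y` runs through the middle edge of `x`, conjugating `y`
by `x` brings its region closer. -/
theorem exists_conj_of_prefix {x y : Cusp} (h1 : x.tail.1 = y.head.1)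
    (h2 : x.tail.2 <+: y.head.2) (hlt : x.depth < y.depth) :
    ∃ z : Cusp, z.toSL = x.toSL * y.toSL * x.toSL⁻¹ ∧ z.depth < y.depth := by
  cases y with
  | near i => simp at hlt
  | far j w =>
    obtain ⟨u, rfl⟩ : x.tail.2 <+: w := by
      rcases List.prefix_concat_iff.1 (by simpa [head] using h2) with h | h
      · have := congrArg List.length h
        rw [length_tail] at this
        simp at this hlt
        omega
      · exact h
    simp only [head] at h1
    subst h1
    obtain ⟨a, ha, had⟩ := exists_conj_W_word u
    obtain ⟨z, hz, hzd⟩ := a.exists_conj_edge x.head.1 x.head.2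
    rw [length_head] at hzd
    refine ⟨z, ?_, by simp only [depth_far, List.length_append, length_tail]; omega⟩
    rw [conj_eq_of_eq_or_eq_neg x.toSL_eq, hz, ha, toSL, edge_append]
    simp [mul_assoc]

/-- Two factors whose paths cancel at equal depth are two consecutive ones of the three regions at
the base vertex, with product `delta`. -/
theorem hurwitzEquiv_of_not_apart_of_depth_eq {x y : Cusp} (h : ¬ Apart x y)
    (hd : x.depth = y.depth) : HurwitzEquiv [x.toSL, y.toSL] [V, U] := by
  simp only [Apart, not_not] at h
  obtain ⟨h1, h2⟩ := h
  have hlen : x.tail.2.length = y.head.2.length := by rw [length_tail, length_head, hd]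
  have h2 : x.tail.2 = y.head.2 := by
    rcases h2 with h | h
    · exact h.eq_of_length hlen
    · exact (h.eq_of_length hlen.symm).symm
  have base (i : Fin 3) : HurwitzEquiv [(near i).toSL, (near (i + 1)).toSL]
      [(near (i + 1)).toSL, (near (i + 2)).toSL] := by
    have e : (near (i + 2)).toSL =
        (near (i + 1)).toSL⁻¹ * (near i).toSL * (near (i + 1)).toSL := by
      revert i; decide
    rw [e]
    exact hurwitzEquiv_right _ _
  have hV : (near 2).toSL = V := by decide
  have hU : (near 0).toSL = U := by decide
  obtain i | ⟨i, w⟩ := x <;> obtain j | ⟨j, w'⟩ := y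
  · obtain rfl : i + 1 = j := h1
    rw [← hV, ← hU]
    clear h2 hlen hd
    fin_cases i
    · exact (base 0).trans (base 1)
    · exact base 1
    · exact .refl _
  · simp at hd
  · simp at hd
  · simp [tail, head] at h2

/-! ### Reduced products -/

/-- Along a reduced product the paths do not cancel, so the path to the image of the base vertex
starts with the path of the first factor up to its middle edge. -/
theorem beyond_head_of_isChain (x : Cusp) (l : List Cusp) (h : (x :: l).IsChain Apart) :
    Beyond (edge x.head.1 x.head.2) ((x :: l).map toSL).prod := by
  induction l generalizing x with
  | nil =>
    exact aux x 1 (not_beyond_edge_one _ _)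
  | cons y l ih =>
    rw [List.isChain_cons_cons] at h
    have hy := ih y h.2
    exact aux x _ fun hx => h.1 (hx.nested hy)
where
  aux (x : Cusp) (X : SL(2, ℤ)) (hX : ¬ Beyond (edge x.tail.1 x.tail.2) X) :
      Beyond (edge x.head.1 x.head.2) (x.toSL * X) := by
    have key : Beyond (edge x.head.1 x.head.2)
        (edge x.head.1 x.head.2 * W * (edge x.tail.1 x.tail.2)⁻¹ * X) := by
      have := ahead_W_mul_of_not_ahead hX
      simpa [Beyond, mul_assoc] using this
    rcases x.toSL_eq with h | h
    · rwa [h]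
    · rw [h, neg_mul, beyond_neg_iff]; exact key

/-- A reduced product equal to `U ^ n` up to a power of `delta` consists of `n` factors `U`. -/
theorem eq_replicate_of_isChain (l : List Cusp) (h : l.IsChain Apart) (n k : ℕ)
    (hp : (l.map toSL).prod = U ^ n * delta ^ k) : l.map toSL = List.replicate n U := by
  induction l generalizing n with
  | nil =>
    cases n with
    | zero => rfl
    | succ n =>
      have := (ahead_U_pow_succ n).mul_delta_pow k
      rw [← hp] at this
      exact absurd this not_ahead_one
  | cons x l ih =>
    have hb := x.beyond_head_of_isChain l h
    rw [hp] at hb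
    replace hb := hb.of_mul_delta_pow
    cases n with
    | zero => exact absurd (by simpa using hb) (not_beyond_edge_one _ _)
    | succ n =>
      have h0 : Beyond (edge 0 []) (U ^ (n + 1)) := by
        simpa [Beyond, edge] using ahead_U_pow_succ n
      have hx : x = near 0 := by
        have h1 := (hb.nested h0).1
        cases x with
        | near i => simpa [head] using h1
        | far j w =>
          simp only [head] at h1 hb
          subst h1
          exact absurd (by simp [edge]) (U_pow_ne_wordMatrix_mul hb w (n + 1))
      have hxU : x.toSL = U := by rw [hx]; decide
      rw [List.map_cons, hxU, List.replicate_succ, ih h.tail n]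
      rw [List.map_cons, List.prod_cons, hxU, pow_succ', mul_assoc, mul_right_inj] at hp
      exact hp

end Cusp

/-! ### The normal form of a factorization -/

theorem vuPow_add (a b : ℕ) : vuPow (a + b) = vuPow a ++ vuPow b := by
  rw [vuPow, List.replicate_add, List.flatten_append]; rfl

theorem vuPow_one : vuPow 1 = [V, U] := rfl

theorem length_vuPow (k : ℕ) : (vuPow k).length = 2 * k := by
  induction k with
  | zero => rfl
  | succ k ih => rw [vuPow_add, List.length_append, ih, vuPow_one]; simp; ring

theorem prod_vuPow (k : ℕ) : (vuPow k).prod = delta ^ k := by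
  induction k with
  | zero => rfl
  | succ k ih => rw [vuPow_add, List.prod_append, ih, vuPow_one, pow_succ]; simp [delta]

/-- Every product of conjugates of `U` is Hurwitz equivalent to a reduced one followed by
factors `V, U, …, V, U`. -/
theorem exists_reduced (l : List Cusp) :
    ∃ (l' : List Cusp) (k : ℕ), l'.IsChain Cusp.Apart ∧
      HurwitzEquiv (l.map Cusp.toSL) (l'.map Cusp.toSL ++ vuPow k) := by
  -- The measure drops by at least one under every shortening and every removal of two factors.
  induction hN : l.length + (l.map Cusp.depth).sum using Nat.strong_induction_on generalizing l with
  | _ N ih =>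
  subst hN
  by_cases hc : l.IsChain Cusp.Apart
  · exact ⟨l, 0, hc, by simpa [vuPow] using HurwitzEquiv.refl _⟩
  rw [List.isChain_iff_forall_rel_of_append_cons_cons] at hc
  push Not at hc
  obtain ⟨x, y, l₁, l₂, rfl, hxy⟩ := hc
  rcases lt_trichotomy x.depth y.depth with hlt | heq | hlt
  · have h := hxy
    simp only [Cusp.Apart, not_not] at h
    have h2 : x.tail.2 <+: y.head.2 := by
      rcases h.2 with h' | h'
      · exact h'
      · have := h'.length_le
        rw [x.length_tail, y.length_head] at this
        omega
    obtain ⟨z, hz, hzd⟩ := Cusp.exists_conj_of_prefix h.1 h2 hlt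
    obtain ⟨l', k, hl', he⟩ := ih _ (by simp; omega) (l₁ ++ z :: x :: l₂) rfl
    refine ⟨l', k, hl', HurwitzEquiv.trans ?_ he⟩
    simpa [hz] using (hurwitzEquiv_left x.toSL y.toSL).append_append
      (l₁.map Cusp.toSL) (l₂.map Cusp.toSL)
  · obtain ⟨l', k, hl', he⟩ := ih _ (by
      have : Cusp.depth ∘ Cusp.rotate = Cusp.depth := funext Cusp.depth_rotate
      simp [this]; omega) (l₁ ++ l₂.map Cusp.rotate) rfl
    refine ⟨l', k + 1, hl', ?_⟩
    have h₁ := (Cusp.hurwitzEquiv_of_not_apart_of_depth_eq hxy heq).append_append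
      (l₁.map Cusp.toSL) (l₂.map Cusp.toSL)
    have h₂ := (hurwitzEquiv_slide V U (l₂.map Cusp.toSL)).append_append (l₁.map Cusp.toSL) []
    have h₃ := he.append_right [V, U]
    have e : Cusp.toSL ∘ Cusp.rotate = fun x => V * U * (Cusp.toSL x * (V * U)⁻¹) := by
      funext x
      simpa [mul_assoc, delta] using x.toSL_rotate
    rw [vuPow_add, vuPow_one, ← List.append_assoc]
    refine HurwitzEquiv.trans (by simpa using h₁) (HurwitzEquiv.trans ?_ h₃)
    simpa [e, Function.comp_def, mul_assoc] using h₂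
  · have h := hxy
    simp only [Cusp.Apart, not_not] at h
    have h2 : y.head.2 <+: x.tail.2 := by
      rcases h.2 with h' | h'
      · have := h'.length_le
        rw [x.length_tail, y.length_head] at this
        omega
      · exact h'
    obtain ⟨z, hz, hzd⟩ := Cusp.exists_conj_inv_of_prefix h.1 h2 hlt
    obtain ⟨l', k, hl', he⟩ := ih _ (by simp; omega) (l₁ ++ y :: z :: l₂) rfl
    refine ⟨l', k, hl', HurwitzEquiv.trans ?_ he⟩
    simpa [hz] using (hurwitzEquiv_right x.toSL y.toSL).append_append
      (l₁.map Cusp.toSL) (l₂.map Cusp.toSL)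

/-- The normal form of the factorizations of `U ^ n * delta ^ m`. -/
theorem hurwitzEquiv_normalForm {G : List SL(2, ℤ)} (hconj : ∀ g ∈ G, IsConj U g) {n m : ℕ}
    (hm : m < 6) (hprod : G.prod = U ^ n * delta ^ m) :
    ∃ s, HurwitzEquiv G (List.replicate n U ++ vuPow (m + 6 * s)) := by
  obtain ⟨l, rfl⟩ : ∃ l : List Cusp, l.map Cusp.toSL = G := by
    clear hprod
    induction G with
    | nil => exact ⟨[], rfl⟩
    | cons g G ih =>
      simp only [List.forall_mem_cons] at hconj
      obtain ⟨x, rfl⟩ := Cusp.exists_toSL_eq hconj.1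
      obtain ⟨l, rfl⟩ := ih hconj.2
      exact ⟨x :: l, rfl⟩
  obtain ⟨l', k, hl', he⟩ := exists_reduced l
  have hp := he.prod_eq
  rw [hprod, List.prod_append, prod_vuPow] at hp
  have hl := Cusp.eq_replicate_of_isChain l' hl' n (m + 5 * k) (by
    rw [pow_add, ← mul_assoc, hp, mul_assoc, ← pow_add, show k + 5 * k = 6 * k by ring, pow_mul,
      delta_pow_six, one_pow, mul_one])
  rw [hl] at he hp
  simp only [List.prod_replicate, mul_right_inj] at hp
  obtain ⟨s, rfl⟩ := delta_pow_injOn hm hp.symm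
  exact ⟨s, he⟩

/-! ### The matrices of Kodaira's list -/

namespace KodairaType

/-- The number `n` such that the monodromy is `U ^ n` times a power of `delta`. -/
def uExponent : KodairaType → ℕ
  | I _ n => n
  | II => 0
  | III => 1
  | IV => 0
  | IStar n => n
  | IIStar => 0
  | IIIStar => 1
  | IVStar => 0

/-- The exponent modulo `6` of `delta` in the monodromy. -/
def deltaExponent : KodairaType → ℕ
  | I _ _ => 0
  | II => 1
  | III => 1
  | IV => 2
  | IStar _ => 3
  | IIStar => 5
  | IIIStar => 4
  | IVStar => 4

theorem deltaExponent_lt (T : KodairaType) : T.deltaExponent < 6 := by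
  cases T <;> simp [deltaExponent]

theorem monodromy_I (w : ℕ+) (n : ℕ) : (I w n).monodromy = U ^ n := by
  obtain ⟨a, b, c, d⟩ := U_pow_entries n
  ext i j
  fin_cases i <;> fin_cases j <;> simp [monodromy, a, b, c, d, -Matrix.SpecialLinearGroup.coe_pow]

theorem monodromy_IStar (n : ℕ) : (IStar n).monodromy = -U ^ n := by
  obtain ⟨a, b, c, d⟩ := U_pow_entries n
  ext i j
  fin_cases i <;> fin_cases j <;> simp [monodromy, a, b, c, d, -Matrix.SpecialLinearGroup.coe_pow]

theorem monodromy_eq (T : KodairaType) :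
    T.monodromy = U ^ T.uExponent * delta ^ T.deltaExponent := by
  cases T with
  | I w n => simp [uExponent, deltaExponent, monodromy_I]
  | IStar n => simp [uExponent, deltaExponent, monodromy_IStar, delta_pow_three]
  | _ => decide

/-- The type whose monodromy is the opposite of that of a starred type. -/
def unstar : KodairaType → KodairaType
  | IStar n => I 1 n
  | IIStar => IV
  | IIIStar => III
  | IVStar => II
  | T => T

theorem monodromy_unstar {T : KodairaType} (hT : T.IsStarred) :
    T.unstar.monodromy = -T.monodromy := by
  cases T with
  | IStar n => simp [unstar, monodromy_I, monodromy_IStar]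
  | IIStar => decide
  | IIIStar => decide
  | IVStar => decide
  | _ => exact hT.elim

theorem hurwitzEquiv_braid_append (l : List SL(2, ℤ)) :
    HurwitzEquiv ([U, V, U] ++ l) ([V, U, V] ++ l) :=
  (hurwitzEquiv_braid (by decide)).append_right l

theorem hurwitzEquiv_mnf {T : KodairaType} (hT : ¬ T.IsStarred) (k : ℕ) :
    HurwitzEquiv (List.replicate T.uExponent U ++ vuPow (T.deltaExponent + k))
      (T.mnf ++ vuPow k) := by
  rw [vuPow_add]
  cases T with
  | I w n => exact .refl _
  | II => exact .refl _
  | III => exact hurwitzEquiv_braid_append _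
  | IV => exact .refl _
  | _ => exact absurd trivial hT

theorem uExponent_unstar (T : KodairaType) : T.unstar.uExponent = T.uExponent := by
  cases T <;> rfl

theorem deltaExponent_unstar {T : KodairaType} (hT : T.IsStarred) :
    T.deltaExponent = T.unstar.deltaExponent + 3 := by
  cases T <;> first | exact hT.elim | rfl

theorem not_isStarred_unstar (T : KodairaType) : ¬ T.unstar.IsStarred := by
  cases T <;> exact id

theorem length_mnf_of_isStarred {T : KodairaType} (hT : T.IsStarred) :
    T.mnf.length = T.unstar.mnf.length + 6 := by
  cases T <;> first | exact hT.elim | simp [mnf, unstar, length_vuPow]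

end KodairaType

end KodairaFactorization

theorem theorem4p6 (T : KodairaFactorization.KodairaType)
    (r : ℕ) (G : List SL(2, ℤ)) (hr : G.length = r)
    (hconj : ∀ g ∈ G, IsConj KodairaFactorization.U g)
    (hprod : G.prod = T.monodromy) :
    T.mnf.length ≤ r ∧
    (¬ T.IsStarred → ∃ s : ℕ, r = T.mnf.length + 12 * s ∧
      KodairaFactorization.HurwitzEquiv G
        (T.mnf ++ KodairaFactorization.vuPow (6 * s))) ∧
    (T.IsStarred → ∃ C : List SL(2, ℤ),
      KodairaFactorization.IsMNF (-T.monodromy) C ∧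
      ∃ s : ℕ, r = C.length + 6 + 12 * s ∧
        KodairaFactorization.HurwitzEquiv G
          (C ++ KodairaFactorization.vuPow (6 * s + 3))) := by
  open KodairaFactorization KodairaType in
  rw [T.monodromy_eq] at hprod
  obtain ⟨s, hs⟩ := hurwitzEquiv_normalForm hconj T.deltaExponent_lt hprod
  by_cases hT : T.IsStarred
  · rw [← T.uExponent_unstar, deltaExponent_unstar hT, add_assoc, add_comm 3] at hs
    replace hs := hs.trans (hurwitzEquiv_mnf T.not_isStarred_unstar (6 * s + 3))
    have hlen : r = T.unstar.mnf.length + 6 + 12 * s := by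
      rw [← hr, hs.length_eq, List.length_append, length_vuPow]
      ring
    exact ⟨by rw [length_mnf_of_isStarred hT]; omega, fun h => absurd hT h,
      fun _ => ⟨T.unstar.mnf, ⟨T.unstar, monodromy_unstar hT, rfl⟩, s, hlen, hs⟩⟩
  · replace hs := hs.trans (hurwitzEquiv_mnf hT (6 * s))
    have hlen : r = T.mnf.length + 12 * s := by
      rw [← hr, hs.length_eq, List.length_append, length_vuPow]
      ring
    exact ⟨by omega, fun _ => ⟨s, hlen, hs⟩, fun h => absurd h hT⟩
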